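/- Let $s>0$. For the equation $u_t=u_{xx}+\dfrac{u^3}{1+su^2}$ ($t>0$, $x\in\mathbb R$) consider traveling waves $u(t,x)=\phi(\xi)$, $\xi=x-ct$, $c>0$, whose profile $\phi\in C^2(\mathbb R)$ satisfies $$-c\,\phi'=\phi''+\frac{\phi^3}{1+s\phi^2}\qquad\text{on }\mathbb R. \tag{1}$$ There is a critical value $c_*>0$, given explicitly by $c_*=2/\sqrt s$, such that the following holds. (i) If $0<c<c_*$, there exists an unbounded traveling wave solution that oscillates infinitely many times: a solution $\phi$ of (1) on $\mathbb R$ with $\phi(+\infty)=0$, with $\|(\phi(\xi),\phi'(\xi))\|\to+\infty$ as $\xi\to-\infty$, $\limsup_{\xi\to-\infty}\phi(\xi)=+\infty$, $\liminf_{\xi\to-\infty}\phi(\xi)=-\infty$, and which changes sign at infinitely many points. (ii) If $c\ge c_*$, there exists a one-parameter family $(\phi_p)_{p>0}$ of unbounded traveling wave solutions, no two of which are translates of each other, such that every $\phi=\phi_p$ satisfies: (ii-1) $\phi$ satisfies (1) on $\mathbb R$, $\phi(-\infty)=+\infty$ and $\phi(+\infty)=0$; (ii-2) there exists a unique point $\xi^*\in(-\infty,\infty)$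 such that $\phi'(\xi)<0$ for $\xi\in(-\infty,\xi^*)$, $\phi'(\xi^*)=0$ and $\phi(\xi^*)<0$, and $\phi'(\xi)>0$ for $\xi\in(\xi^*,+\infty)$. (In particular $\phi$ changes sign.) -/

import Mathlib

open Filter Topology

/-- `φ` is a profile on the whole line of a traveling wave `u(t,x) = φ(x - c t)` of
`u_t = u_xx + u³ / (1 + s u²)`, i.e. a (classical) solution on `ℝ` of
`-c φ' = φ'' + φ³ / (1 + s φ²)`. -/
def IsWaveProfile (s c : ℝ) (φ : ℝ → ℝ) : Prop :=
  ContDiff ℝ 2 φ ∧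
    ∀ ξ : ℝ, -c * deriv φ ξ = deriv (deriv φ) ξ + φ ξ ^ 3 / (1 + s * φ ξ ^ 2)

/-- The profile `φ` connects `∞` and `0`: `φ(-∞) = +∞` and `φ(+∞) = 0`. -/
def ConnectsInftyZero (φ : ℝ → ℝ) : Prop :=
  Tendsto φ atBot atTop ∧ Tendsto φ atTop (𝓝 0)

/-- `φ` changes sign at `ξ`: it is strictly negative immediately on one side of `ξ` and
strictly positive immediately on the other side. -/
def ChangesSignAt (φ : ℝ → ℝ) (ξ : ℝ) : Prop :=
  ((∀ᶠ η in 𝓝[<] ξ, φ η < 0) ∧ (∀ᶠ η in 𝓝[>] ξ, 0 < φ η)) ∨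
    ((∀ᶠ η in 𝓝[<] ξ, 0 < φ η) ∧ (∀ᶠ η in 𝓝[>] ξ, φ η < 0))

/-- An unbounded traveling wave profile with infinitely many oscillations. Since such a profile
has zeros arbitrarily far to the left, `φ(-∞) = +∞` is replaced by: the orbit `(φ, φ')` comes from
infinity in the phase plane, and `φ` itself takes arbitrarily large positive and
arbitrarily large negative values arbitrarily far to the left. -/
structure IsOscillatingUnboundedWave (s c : ℝ) (φ : ℝ → ℝ) : Prop where
  profile : IsWaveProfile s c φ
  tendsto_zero : Tendsto φ atTop (𝓝 0)
  from_infinity : Tendsto (fun ξ => ‖(φ ξ, deriv φ ξ)‖) atBot atTop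
  unbounded_above : ∀ M : ℝ, ∃ᶠ ξ in atBot, M < φ ξ
  unbounded_below : ∀ M : ℝ, ∃ᶠ ξ in atBot, φ ξ < M
  infinite_sign_changes : {ξ : ℝ | ChangesSignAt φ ξ}.Infinite

/-- `ξ₀` is a turning point of `φ` below zero: `φ' < 0` on `(-∞, ξ₀)`, `φ'(ξ₀) = 0`,
`φ(ξ₀) < 0`, and `φ' > 0` on `(ξ₀, +∞)`. -/
def IsNegativeTurningPoint (φ : ℝ → ℝ) (ξ₀ : ℝ) : Prop :=
  (∀ ξ < ξ₀, deriv φ ξ < 0) ∧ deriv φ ξ₀ = 0 ∧ φ ξ₀ < 0 ∧ (∀ ξ > ξ₀, 0 < deriv φ ξ)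

/-!
Write `f(u) = u³ / (1 + s u²)`. The profile equation is the system `u' = v`, `v' = -c v - f(u)`,
whose vector field is smooth and globally Lipschitz, so all orbits are entire.

The whole phase plane is governed by the strict Lyapunov function
`W = v²/2 + (v + c u)²/2 + 2 F(u)`, `F' = f`, which satisfies `W' = -c v² - c u f(u)`. The
dissipation is bounded away from `0` wherever `W` is, so every orbit tends to the origin at `+∞` and every
nonzero orbit tends to infinity at `-∞` (`IsOrbit.tendsto_atTop_zero`,
`IsOrbit.tendsto_norm_atBot_atTop`). Only the position of the orbit near infinity remains to be
determined, and there `f(u) ≈ u / s` from below for `u > 0`, with characteristic polynomial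
`X² + c X + 1/s`. Its discriminant `c² - 4/s` changes sign at `c = 2 / √s`.

* If `c < 2 / √s` the roots are not real. A nonzero orbit with `u ≥ 0` near `-∞` would have
  `v ≤ 0` and `u → +∞` there, but the Riccati equation for `v / u` then forces `v / u → +∞`
  (`IsOrbit.not_eventually_nonneg`). As `-u` is a profile too, `u` takes both signs arbitrarily far
  to the left; at the maxima in between `v = 0`, so that `u` equals the norm of the orbit
  (`IsOrbit.frequently_lt_fst`).

* If `c ≥ 2 / √s` let `l₁ < 0` be the smaller root. To the left of a zero of `u` with `v < 0` the
  orbit cannot cross the line `v = l₁ u` (`IsOrbit.snd_lt_mul_fst_of_pos_on_Ioo`); hence `u`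
  decreases from `+∞` to this zero. Applied to `u` and to `-u`, this also shows that `u` has no
  further zero to the right, so `u < 0` there, `e^{c x} v` is strictly increasing, and `v` changes
  sign exactly once (`IsOrbit.exists_isNegativeTurningPoint`). The orbits through `(0, -p)`,
  `p > 0`, form the family; since each has a single zero, no two are translates.
-/

/-! ### Global solutions of Lipschitz autonomous equations -/

/-- A globally Lipschitz `C¹` vector field on a Banach space is complete: Picard–Lindelöf yields
solutions on a time interval whose length does not depend on the initial value. -/
theorem exists_forall_hasDerivAt_of_lipschitzWith {E : Type*} [NormedAddCommGroup E]
    [NormedSpace ℝ E] [CompleteSpace E] {F : E → E} {K : NNReal} (hF : LipschitzWith K F)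
    (hF' : ContDiff ℝ 1 F) (x : E) :
    ∃ γ : ℝ → E, γ 0 = x ∧ ∀ t, HasDerivAt γ (F (γ t)) t := by
  have hv : ContMDiff (modelWithCornersSelf ℝ E) (modelWithCornersSelf ℝ E).tangent 1
      (fun x ↦ (⟨x, F x⟩ : TangentBundle (modelWithCornersSelf ℝ E) E)) :=
    contMDiff_vectorSpace_iff_contDiff.2 hF'
  have hε : (0 : ℝ) < 1 / (K + 1) := by positivity
  have hloc (y : E) : ∃ γ : ℝ → E, γ 0 = y ∧ IsMIntegralCurveOn (I := modelWithCornersSelf ℝ E) γ F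
      (Set.Ioo (-(1 / (K + 1) : ℝ)) (1 / (K + 1))) := by
    -- On the ball of radius `‖F y‖` around `y` the field is bounded by `(K + 1) * ‖F y‖`.
    have hpl : IsPicardLindelof (fun _ ↦ F) (tmin := -(1 / (K + 1) : ℝ)) (tmax := 1 / (K + 1))
        ⟨0, by constructor <;> linarith⟩ y ‖F y‖₊ 0 ((K + 1) * ‖F y‖₊) K := by
      refine .of_time_independent (fun z hz ↦ ?_) hF.lipschitzOnWith ?_
      · have h1 : ‖F z‖ ≤ ‖F y‖ + ‖F z - F y‖ := norm_le_norm_add_norm_sub' _ _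
        have h2 := hF.dist_le_mul z y
        rw [dist_eq_norm] at h2
        have h3 : (K : ℝ) * dist z y ≤ K * ‖F y‖ := by
          gcongr
          simpa using hz
        push_cast
        linarith
      · have : (K + 1 : ℝ) ≠ 0 := by positivity
        simp
        field_simp
        rfl
    obtain ⟨γ, h0, hγ⟩ := hpl.exists_eq_forall_mem_Icc_hasDerivWithinAt₀
    refine ⟨γ, h0, fun t ht ↦ ?_⟩
    have := (hγ t (Set.Ioo_subset_Icc_self ht)).hasDerivAt (Icc_mem_nhds ht.1 ht.2)
    exact (hasMFDerivAt_iff_hasFDerivAt.2 this.hasFDerivAt).hasMFDerivWithinAt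
  obtain ⟨γ, h0, hγ⟩ := exists_isMIntegralCurve_of_isMIntegralCurveOn hv hε hloc x
  refine ⟨γ, h0, fun t ↦ ?_⟩
  have h : HasFDerivAt γ ((1 : ℝ →L[ℝ] ℝ).smulRight (F (γ t))) t :=
    hasMFDerivAt_iff_hasFDerivAt.1 (hγ t)
  simpa using h.hasDerivAt

/-! ### The reaction term -/

/-- The reaction term `u³ / (1 + s u²)`. -/
noncomputable def reaction (s u : ℝ) : ℝ := u ^ 3 / (1 + s * u ^ 2)

/-- The primitive of the reaction term that vanishes at `0`. -/
noncomputable def potential (s u : ℝ) : ℝ :=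
  u ^ 2 / (2 * s) - Real.log (1 + s * u ^ 2) / (2 * s ^ 2)

theorem one_add_mul_sq_pos {s : ℝ} (hs : 0 < s) (u : ℝ) : 0 < 1 + s * u ^ 2 := by positivity

theorem reaction_neg (s u : ℝ) : reaction s (-u) = -reaction s u := by
  simp only [reaction, neg_sq]
  ring

theorem reaction_pos {s u : ℝ} (hs : 0 < s) (hu : 0 < u) : 0 < reaction s u := by
  unfold reaction
  positivity

theorem reaction_eq_sub {s : ℝ} (hs : 0 < s) (u : ℝ) :
    reaction s u = u / s - u / (s * (1 + s * u ^ 2)) := by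
  have := (one_add_mul_sq_pos hs u).ne'
  unfold reaction
  field_simp
  ring

theorem contDiff_reaction {s : ℝ} (hs : 0 < s) : ContDiff ℝ 1 (reaction s) :=
  ContDiff.div (by fun_prop) (by fun_prop) fun u ↦ (one_add_mul_sq_pos hs u).ne'

theorem lipschitzWith_reaction {s : ℝ} (hs : 0 < s) :
    LipschitzWith (2 / s).toNNReal (reaction s) := by
  refine .of_dist_le_mul fun a b ↦ ?_
  rw [Real.coe_toNNReal _ (by positivity), Real.dist_eq, Real.dist_eq]
  have ha := one_add_mul_sq_pos hs a
  have hb := one_add_mul_sq_pos hs b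
  have key : reaction s a - reaction s b =
      (a ^ 2 + a * b + b ^ 2 + s * a ^ 2 * b ^ 2) / ((1 + s * a ^ 2) * (1 + s * b ^ 2)) *
        (a - b) := by
    unfold reaction
    field_simp
    ring
  rw [key, abs_mul]
  gcongr
  have h0 : 0 ≤ a ^ 2 + a * b + b ^ 2 + s * a ^ 2 * b ^ 2 := by
    have : 0 ≤ s * a ^ 2 * b ^ 2 := by positivity
    nlinarith [sq_nonneg (a + b), sq_nonneg a, sq_nonneg b]
  rw [abs_of_nonneg (by positivity), div_le_div_iff₀ (by positivity) hs]
  have : 0 ≤ s * (a - b) ^ 2 := by positivity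
  have : 0 ≤ s * a ^ 2 := by positivity
  have : 0 ≤ s * b ^ 2 := by positivity
  have : 0 ≤ (s * a * b) ^ 2 := by positivity
  nlinarith

theorem hasDerivAt_potential {s : ℝ} (hs : 0 < s) (u : ℝ) :
    HasDerivAt (potential s) (reaction s u) u := by
  have hu := (one_add_mul_sq_pos hs u).ne'
  have h1 : HasDerivAt (fun u : ℝ ↦ 1 + s * u ^ 2) (s * (2 * u)) u := by
    simpa using ((hasDerivAt_pow 2 u).const_mul s).const_add 1
  have h2 : HasDerivAt (fun u : ℝ ↦ u ^ 2 / (2 * s)) (2 * u / (2 * s)) u := by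
    simpa using (hasDerivAt_pow 2 u).div_const (2 * s)
  refine (h2.sub ((h1.log hu).div_const (2 * s ^ 2))).congr_deriv ?_
  unfold reaction
  field_simp
  ring

theorem potential_nonneg {s : ℝ} (hs : 0 < s) (u : ℝ) : 0 ≤ potential s u := by
  have h := Real.log_le_sub_one_of_pos (one_add_mul_sq_pos hs u)
  have : potential s u = (s * u ^ 2 - Real.log (1 + s * u ^ 2)) / (2 * s ^ 2) := by
    unfold potential
    field_simp
  rw [this]
  exact div_nonneg (by linarith) (by positivity)

theorem potential_le {s : ℝ} (hs : 0 < s) (u : ℝ) : potential s u ≤ u ^ 2 / (2 * s) := by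
  have h : 0 ≤ Real.log (1 + s * u ^ 2) := Real.log_nonneg (by nlinarith [sq_nonneg u])
  exact sub_le_self _ (by positivity)

/-! ### Orbits in the phase plane -/

/-- `(u, v)` is an entire solution of the first order system `u' = v`, `v' = -c v - f(u)`
equivalent to the profile equation. -/
structure IsOrbit (s c : ℝ) (u v : ℝ → ℝ) : Prop where
  hasDerivAt_fst : ∀ x, HasDerivAt u (v x) x
  hasDerivAt_snd : ∀ x, HasDerivAt v (-c * v x - reaction s (u x)) x

theorem exists_isOrbit {s : ℝ} (hs : 0 < s) (c a b : ℝ) :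
    ∃ u v : ℝ → ℝ, u 0 = a ∧ v 0 = b ∧ IsOrbit s c u v := by
  have hlip := LipschitzWith.prodMk (LipschitzWith.prod_snd (α := ℝ) (β := ℝ))
    (((lipschitzWith_smul (-c)).comp (LipschitzWith.prod_snd (α := ℝ) (β := ℝ))).sub
      ((lipschitzWith_reaction hs).comp LipschitzWith.prod_fst))
  have hsmooth : ContDiff ℝ 1 fun p : ℝ × ℝ ↦ (p.2, -c • p.2 - reaction s p.1) := by
    have := (contDiff_reaction hs).comp (contDiff_fst (𝕜 := ℝ) (E := ℝ) (F := ℝ))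
    exact contDiff_snd.prodMk ((contDiff_snd.const_smul (-c)).sub this)
  obtain ⟨γ, h0, hγ⟩ := exists_forall_hasDerivAt_of_lipschitzWith hlip hsmooth (a, b)
  refine ⟨fun x ↦ (γ x).1, fun x ↦ (γ x).2, by simp [h0], by simp [h0], fun x ↦ ?_, fun x ↦ ?_⟩
  · exact (hγ x).fst
  · exact (hγ x).snd

namespace IsOrbit

variable {s c : ℝ} {u v : ℝ → ℝ}

theorem neg (h : IsOrbit s c u v) : IsOrbit s c (fun x ↦ -u x) (fun x ↦ -v x) where
  hasDerivAt_fst x := (h.hasDerivAt_fst x).neg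
  hasDerivAt_snd x := (h.hasDerivAt_snd x).neg.congr_deriv (by rw [reaction_neg]; ring)

theorem continuous_fst (h : IsOrbit s c u v) : Continuous u :=
  continuous_iff_continuousAt.2 fun x ↦ (h.hasDerivAt_fst x).continuousAt

theorem continuous_snd (h : IsOrbit s c u v) : Continuous v :=
  continuous_iff_continuousAt.2 fun x ↦ (h.hasDerivAt_snd x).continuousAt

theorem deriv_fst (h : IsOrbit s c u v) : deriv u = v :=
  funext fun x ↦ (h.hasDerivAt_fst x).deriv

theorem isWaveProfile (hs : 0 < s) (h : IsOrbit s c u v) : IsWaveProfile s c u := by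
  have hv : deriv v = fun x ↦ -c * v x - reaction s (u x) :=
    funext fun x ↦ (h.hasDerivAt_snd x).deriv
  constructor
  · rw [show (2 : WithTop ℕ∞) = 1 + 1 by norm_num, contDiff_succ_iff_deriv, h.deriv_fst]
    refine ⟨fun x ↦ (h.hasDerivAt_fst x).differentiableAt, by simp, ?_⟩
    refine contDiff_one_iff_deriv.2 ⟨fun x ↦ (h.hasDerivAt_snd x).differentiableAt, ?_⟩
    rw [hv]
    exact (continuous_const.mul h.continuous_snd).sub
      ((contDiff_reaction hs).continuous.comp h.continuous_fst)
  · intro x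
    rw [h.deriv_fst, hv]
    simp only [reaction]
    ring

/-- In divergence form the equation reads `(e^{c x} v)' = -e^{c x} f(u)`. -/
theorem hasDerivAt_exp_mul_snd (h : IsOrbit s c u v) (x : ℝ) :
    HasDerivAt (fun x ↦ Real.exp (c * x) * v x) (-(Real.exp (c * x) * reaction s (u x))) x := by
  have h1 : HasDerivAt (fun x ↦ Real.exp (c * x)) (Real.exp (c * x) * c) x := by
    simpa using ((hasDerivAt_id x).const_mul c).exp
  exact (h1.mul (h.hasDerivAt_snd x)).congr_deriv (by ring)

end IsOrbit

/-! ### A strict Lyapunov function -/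

theorem le_sub_mul_of_hasDerivAt_le {g g' : ℝ → ℝ} {δ a b : ℝ} (hab : a ≤ b)
    (hg : ∀ x ∈ Set.Icc a b, HasDerivAt g (g' x) x) (h : ∀ x ∈ Set.Icc a b, g' x ≤ -δ) :
    g b ≤ g a - δ * (b - a) := by
  have := (convex_Icc a b).image_sub_le_mul_sub_of_deriv_le (f := g) (C := -δ)
    (fun x hx ↦ (hg x hx).continuousAt.continuousWithinAt)
    (fun x hx ↦ (hg x (interior_subset hx)).differentiableAt.differentiableWithinAt)
    (fun x hx ↦ by
      rw [(hg x (interior_subset hx)).deriv]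
      exact h x (interior_subset hx)) a (Set.left_mem_Icc.2 hab) b (Set.right_mem_Icc.2 hab) hab
  linarith

theorem tendsto_atBot_atTop_of_hasDerivAt_le {g g' : ℝ → ℝ} {δ b : ℝ} (hδ : 0 < δ)
    (hg : ∀ x ≤ b, HasDerivAt g (g' x) x) (h : ∀ x ≤ b, g' x ≤ -δ) : Tendsto g atBot atTop := by
  have hlin : Tendsto (fun x ↦ g b + δ * (b - x)) atBot atTop := by
    refine tendsto_atTop_add_const_left _ _ (Tendsto.const_mul_atTop hδ ?_)
    exact tendsto_atTop_add_const_left _ _ tendsto_neg_atBot_atTop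
  refine tendsto_atTop_mono' _ ?_ hlin
  filter_upwards [eventually_le_atBot b] with x hx
  have := le_sub_mul_of_hasDerivAt_le hx (fun y hy ↦ hg y hy.2) fun y hy ↦ h y hy.2
  linarith

/-- The sum of the mechanical energy `v²/2 + F(u)` and of the Liénard energy
`(v + c u)²/2 + F(u)`, where `F` is the potential. The first one only dissipates `c v²`, the
second one only `c u f(u)`; their sum is strictly decreasing along nonzero orbits. -/
noncomputable def lyapunov (s c u v : ℝ) : ℝ :=
  v ^ 2 / 2 + (v + c * u) ^ 2 / 2 + 2 * potential s u

theorem mul_sq_le_lyapunov {s : ℝ} (hs : 0 < s) (c u v : ℝ) :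
    c ^ 2 * u ^ 2 / 4 ≤ lyapunov s c u v := by
  have := potential_nonneg hs u
  unfold lyapunov
  nlinarith [sq_nonneg (2 * v + c * u)]

theorem sq_le_lyapunov {s : ℝ} (hs : 0 < s) (c u v : ℝ) : v ^ 2 / 2 ≤ lyapunov s c u v := by
  have := potential_nonneg hs u
  unfold lyapunov
  nlinarith [sq_nonneg (v + c * u)]

theorem lyapunov_le {s : ℝ} (hs : 0 < s) (c u v : ℝ) :
    lyapunov s c u v ≤ 3 / 2 * v ^ 2 + (c ^ 2 + 1 / s) * u ^ 2 := by
  have h := potential_le hs u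
  have : u ^ 2 / (2 * s) = 1 / s * u ^ 2 / 2 := by
    field_simp
  unfold lyapunov
  nlinarith [sq_nonneg (v - c * u)]

theorem lyapunov_neg (s c u v : ℝ) : lyapunov s c (-u) (-v) = lyapunov s c u v := by
  simp only [lyapunov, potential]
  ring_nf

theorem lyapunov_pos_of_snd_ne_zero {s : ℝ} (hs : 0 < s) (c u : ℝ) {v : ℝ} (hv : v ≠ 0) :
    0 < lyapunov s c u v :=
  lt_of_lt_of_le (by positivity) (sq_le_lyapunov hs c u v)

theorem mul_reaction_eq (s u : ℝ) : u * reaction s u = (u ^ 2) ^ 2 / (1 + s * u ^ 2) := by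
  unfold reaction
  ring

theorem mul_reaction_nonneg {s : ℝ} (hs : 0 < s) (u : ℝ) : 0 ≤ u * reaction s u := by
  rw [mul_reaction_eq]
  positivity

theorem mul_reaction_le {s : ℝ} (hs : 0 < s) (u : ℝ) : u * reaction s u ≤ u ^ 2 / s := by
  rw [mul_reaction_eq, div_le_div_iff₀ (one_add_mul_sq_pos hs u) hs]
  nlinarith [sq_nonneg u]

theorem div_le_mul_reaction {s m u : ℝ} (hs : 0 < s) (hm : 0 ≤ m) (h : m ≤ u ^ 2) :
    m ^ 2 / (1 + s * m) ≤ u * reaction s u := by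
  rw [mul_reaction_eq, div_le_div_iff₀ (by positivity) (one_add_mul_sq_pos hs u)]
  have h1 : m ^ 2 ≤ (u ^ 2) ^ 2 := by gcongr
  have h2 : 0 ≤ s * (m * u ^ 2 * (u ^ 2 - m)) := by
    have := sub_nonneg.2 h
    positivity
  nlinarith

/-- Away from the origin the dissipation rate is bounded below by a positive constant. -/
theorem exists_dissipation_of_le_lyapunov {s c w : ℝ} (hs : 0 < s) (hc : 0 < c) (hw : 0 < w) :
    ∃ δ > 0, ∀ u v, w ≤ lyapunov s c u v → δ ≤ c * v ^ 2 + c * (u * reaction s u) := by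
  set m := w / (2 * (c ^ 2 + 1 / s)) with hm
  have hm0 : 0 < m := by positivity
  refine ⟨min (c * (w / 3)) (c * (m ^ 2 / (1 + s * m))), by positivity, fun u v h ↦ ?_⟩
  have h1 := h.trans (lyapunov_le hs c u v)
  have h2 := mul_nonneg hc.le (mul_reaction_nonneg hs u)
  have h3 : 0 ≤ c * v ^ 2 := by positivity
  rcases le_total (w / 3) (v ^ 2) with hv | hv
  · have : c * (w / 3) ≤ c * v ^ 2 := by gcongr
    exact (min_le_left _ _).trans (by linarith)
  · have hu : m ≤ u ^ 2 := by
      rw [hm, div_le_iff₀ (by positivity)]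
      linarith
    have := mul_le_mul_of_nonneg_left (div_le_mul_reaction hs hm0.le hu) hc.le
    exact (min_le_right _ _).trans (by linarith)

namespace IsOrbit

variable {s c : ℝ} {u v : ℝ → ℝ}

theorem hasDerivAt_lyapunov (hs : 0 < s) (h : IsOrbit s c u v) (x : ℝ) :
    HasDerivAt (fun x ↦ lyapunov s c (u x) (v x))
      (-(c * v x ^ 2 + c * (u x * reaction s (u x)))) x := by
  have hu := h.hasDerivAt_fst x
  have hv := h.hasDerivAt_snd x
  have hF := (hasDerivAt_potential hs (u x)).comp x hu
  refine ((((hv.pow 2).div_const 2).add (((hv.add (hu.const_mul c)).pow 2).div_const 2)).add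
    (hF.const_mul 2)).congr_deriv ?_
  simp
  ring

theorem antitone_lyapunov (hs : 0 < s) (hc : 0 < c) (h : IsOrbit s c u v) :
    Antitone fun x ↦ lyapunov s c (u x) (v x) :=
  antitone_of_hasDerivAt_nonpos (h.hasDerivAt_lyapunov hs) fun x ↦ by
    have := mul_nonneg hc.le (mul_reaction_nonneg hs (u x))
    have : 0 ≤ c * v x ^ 2 := by positivity
    simp only [Pi.zero_apply]
    linarith

/-- A nonzero orbit never reaches the origin, by Grönwall's inequality for the Lyapunov
function. -/
theorem lyapunov_pos (hs : 0 < s) (hc : 0 < c) (h : IsOrbit s c u v) {a : ℝ}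
    (ha : 0 < lyapunov s c (u a) (v a)) (x : ℝ) : 0 < lyapunov s c (u x) (v x) := by
  rcases le_total x a with hx | hx
  · exact ha.trans_le (h.antitone_lyapunov hs hc hx)
  set C := 2 * c + 4 / (c * s) with hC
  have hmono : Monotone fun x ↦ Real.exp (C * x) * lyapunov s c (u x) (v x) := by
    have hexp (x : ℝ) : HasDerivAt (fun x ↦ Real.exp (C * x)) (Real.exp (C * x) * C) x := by
      simpa using ((hasDerivAt_id x).const_mul C).exp
    refine monotone_of_hasDerivAt_nonneg (fun x ↦ (hexp x).mul (h.hasDerivAt_lyapunov hs x))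
      fun x ↦ ?_
    have h1 := mul_sq_le_lyapunov hs c (u x) (v x)
    have h2 := sq_le_lyapunov hs c (u x) (v x)
    have h3 := mul_reaction_le hs (u x)
    have h4 : c * (u x * reaction s (u x)) ≤ 4 / (c * s) * lyapunov s c (u x) (v x) :=
      calc c * (u x * reaction s (u x)) ≤ c * (u x ^ 2 / s) := by gcongr
        _ = 4 / (c * s) * (c ^ 2 * u x ^ 2 / 4) := by field_simp
        _ ≤ _ := by gcongr
    have h5 : c * v x ^ 2 ≤ 2 * c * lyapunov s c (u x) (v x) := by nlinarith
    have : 0 ≤ Real.exp (C * x) * (C * lyapunov s c (u x) (v x) -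
        (c * v x ^ 2 + c * (u x * reaction s (u x)))) :=
      mul_nonneg (Real.exp_nonneg _) (by rw [hC]; linarith)
    simp only [Pi.zero_apply]
    linarith
  have h1 : 0 < Real.exp (C * a) * lyapunov s c (u a) (v a) := by positivity
  exact pos_of_mul_pos_right (h1.trans_le (hmono hx)) (Real.exp_nonneg _)

theorem snd_ne_zero_of_fst_eq_zero (hs : 0 < s) (hc : 0 < c) (h : IsOrbit s c u v) {a x : ℝ}
    (ha : 0 < lyapunov s c (u a) (v a)) (hx : u x = 0) : v x ≠ 0 := fun hv ↦ by
  have := h.lyapunov_pos hs hc ha x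
  simp [lyapunov, potential, hx, hv] at this

theorem tendsto_atTop_zero (hs : 0 < s) (hc : 0 < c) (h : IsOrbit s c u v) :
    Tendsto u atTop (𝓝 0) := by
  refine Metric.tendsto_atTop.2 fun ε hε ↦ ?_
  have hw : 0 < c ^ 2 * ε ^ 2 / 4 := by positivity
  obtain ⟨N, hN⟩ : ∃ N, lyapunov s c (u N) (v N) < c ^ 2 * ε ^ 2 / 4 := by
    by_contra! hcon
    obtain ⟨δ, hδ, hdis⟩ := exists_dissipation_of_le_lyapunov hs hc hw
    set b := lyapunov s c (u 0) (v 0) / δ with hb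
    have hL : 0 < lyapunov s c (u 0) (v 0) := hw.trans_le (hcon 0)
    have := le_sub_mul_of_hasDerivAt_le (a := 0) (b := b) (by positivity)
      (fun x _ ↦ h.hasDerivAt_lyapunov hs x) fun x _ ↦ neg_le_neg (hdis _ _ (hcon x))
    have hδb : δ * b = lyapunov s c (u 0) (v 0) := by rw [hb]; field_simp
    linarith [hcon b]
  refine ⟨N, fun x hx ↦ ?_⟩
  have h1 := (mul_sq_le_lyapunov hs c (u x) (v x)).trans (h.antitone_lyapunov hs hc hx)
  rw [Real.dist_eq, sub_zero]
  refine abs_lt_of_sq_lt_sq ?_ hε.le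
  have h2 : c ^ 2 * u x ^ 2 / 4 < c ^ 2 * ε ^ 2 / 4 := h1.trans_lt hN
  have hc2 : 0 < c ^ 2 := by positivity
  exact lt_of_mul_lt_mul_left (by linarith) hc2.le

theorem tendsto_norm_atBot_atTop (hs : 0 < s) (hc : 0 < c) (h : IsOrbit s c u v) {a : ℝ}
    (ha : 0 < lyapunov s c (u a) (v a)) : Tendsto (fun x ↦ ‖(u x, v x)‖) atBot atTop := by
  obtain ⟨δ, hδ, hdis⟩ := exists_dissipation_of_le_lyapunov hs hc ha
  have hL := tendsto_atBot_atTop_of_hasDerivAt_le hδ (b := a)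
    (fun x _ ↦ h.hasDerivAt_lyapunov hs x)
    fun x hx ↦ neg_le_neg (hdis _ _ (h.antitone_lyapunov hs hc hx))
  have hbound (x : ℝ) : lyapunov s c (u x) (v x) ≤
      (3 / 2 + (c ^ 2 + 1 / s)) * ‖(u x, v x)‖ ^ 2 := by
    have h1 : u x ^ 2 ≤ ‖(u x, v x)‖ ^ 2 := by
      rw [← sq_abs]
      gcongr
      exact norm_fst_le (u x, v x)
    have h2 : v x ^ 2 ≤ ‖(u x, v x)‖ ^ 2 := by
      rw [← sq_abs]
      gcongr
      exact norm_snd_le (u x, v x)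
    refine (lyapunov_le hs c (u x) (v x)).trans ?_
    rw [add_mul (3 / 2)]
    exact add_le_add (by gcongr) (by gcongr)
  have hsq := (tendsto_atTop_mono hbound hL).const_mul_atTop
    (r := (3 / 2 + (c ^ 2 + 1 / s))⁻¹) (by positivity)
  refine tendsto_atTop.2 fun M ↦ ?_
  filter_upwards [hsq.eventually_ge_atTop (M ^ 2)] with x hx
  rw [inv_mul_cancel_left₀ (by positivity)] at hx
  exact (le_abs_self M).trans (abs_le_of_sq_le_sq hx (norm_nonneg _))

end IsOrbit

/-! ### Slow waves: infinitely many oscillations -/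

namespace IsOrbit

variable {s c : ℝ} {u v : ℝ → ℝ}

/-- `e^{c x} v` is nonincreasing as long as `u ≥ 0`. Were it positive somewhere, `v` would be
bounded below by a positive constant further to the left, and `u` would become negative. -/
theorem snd_nonpos_of_nonneg_on_Iic (hs : 0 < s) (hc : 0 < c) (h : IsOrbit s c u v) {T : ℝ}
    (hu : ∀ x ≤ T, 0 ≤ u x) {x : ℝ} (hx : x ≤ T) : v x ≤ 0 := by
  by_contra! hv
  have hanti : AntitoneOn (fun x ↦ Real.exp (c * x) * v x) (Set.Iic T) := by
    refine antitoneOn_of_deriv_nonpos (convex_Iic T)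
      (fun y _ ↦ (h.hasDerivAt_exp_mul_snd y).continuousAt.continuousWithinAt)
      (fun y _ ↦ (h.hasDerivAt_exp_mul_snd y).differentiableAt.differentiableWithinAt)
      fun y hy ↦ ?_
    rw [(h.hasDerivAt_exp_mul_snd y).deriv, neg_nonpos]
    have hy0 : 0 ≤ u y := hu y (interior_subset hy : y ∈ Set.Iic T)
    unfold reaction
    positivity
  have hlow (y : ℝ) (hy : y ≤ x) : -v y ≤ -v x := by
    have h1 : Real.exp (c * x) * v x ≤ Real.exp (c * y) * v y := hanti (hy.trans hx) hx hy
    have h2 : Real.exp (c * y) ≤ Real.exp (c * x) := by gcongr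
    have h3 : 0 < v y := pos_of_mul_pos_right
      ((mul_pos (Real.exp_pos _) hv).trans_le h1) (Real.exp_nonneg _)
    have h4 : Real.exp (c * y) * v y ≤ Real.exp (c * x) * v y := by gcongr
    exact neg_le_neg (le_of_mul_le_mul_left (h1.trans h4) (Real.exp_pos _))
  have hlim := tendsto_atBot_atTop_of_hasDerivAt_le hv (fun y _ ↦ (h.hasDerivAt_fst y).neg) hlow
  obtain ⟨y, hy, hyx⟩ := ((hlim.eventually_gt_atTop 0).and (eventually_le_atBot x)).exists
  have := hu y (hyx.trans hx)
  simp only [Pi.neg_apply] at hy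
  linarith

theorem tendsto_fst_of_nonneg_on_Iic (hs : 0 < s) (hc : 0 < c) (h : IsOrbit s c u v) {a T : ℝ}
    (ha : 0 < lyapunov s c (u a) (v a)) (hu : ∀ x ≤ T, 0 ≤ u x) : Tendsto u atBot atTop := by
  have hanti : AntitoneOn u (Set.Iic T) :=
    antitoneOn_of_deriv_nonpos (convex_Iic T) h.continuous_fst.continuousOn
      (fun y _ ↦ (h.hasDerivAt_fst y).differentiableAt.differentiableWithinAt)
      fun y hy ↦ by
        rw [h.deriv_fst]
        exact h.snd_nonpos_of_nonneg_on_Iic hs hc hu (interior_subset hy : y ∈ Set.Iic T)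
  by_contra hnot
  obtain ⟨M, hM⟩ : ∃ M, ∀ x ≤ T, u x < M := by
    by_contra! hcon
    refine hnot (tendsto_atTop.2 fun M ↦ ?_)
    obtain ⟨x, hx, hxM⟩ := hcon M
    filter_upwards [eventually_le_atBot x] with y hy
    exact hxM.trans (hanti (hy.trans hx) hx hy)
  -- If `u` stays bounded then the norm of the orbit can only be carried by `v → -∞`.
  have hnorm := (h.tendsto_norm_atBot_atTop hs hc ha).eventually_ge_atTop (max M 1)
  obtain ⟨b, hb⟩ := eventually_atBot.1 (hnorm.and (eventually_le_atBot T))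
  refine hnot (tendsto_atBot_atTop_of_hasDerivAt_le one_pos (b := b)
    (fun y _ ↦ h.hasDerivAt_fst y) fun y hy ↦ ?_)
  obtain ⟨h1, h2⟩ := hb y hy
  have hv := h.snd_nonpos_of_nonneg_on_Iic hs hc hu h2
  rw [Prod.norm_def, Real.norm_of_nonneg (hu y h2), Real.norm_of_nonpos hv] at h1
  rcases le_max_iff.1 h1 with h3 | h3
  · exact absurd (hM y h2) (not_lt.2 ((le_max_left _ _).trans h3))
  · linarith [(le_max_right M 1).trans h3]

/-- Below the critical speed a nonzero orbit is not eventually nonnegative at `-∞`: otherwise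
`r = v / u` would be nonpositive, whereas the Riccati equation gives
`(r + c/2)' ≤ -(r + c/2)² - k ≤ -k` with `k > 0` near `-∞`, hence `r → ∞`. -/
theorem not_eventually_nonneg (hs : 0 < s) (hc : 0 < c) (hc' : c ^ 2 < 4 / s)
    (h : IsOrbit s c u v) {a : ℝ} (ha : 0 < lyapunov s c (u a) (v a)) :
    ¬∀ᶠ x in atBot, 0 ≤ u x := by
  intro hev
  obtain ⟨T, hT⟩ := eventually_atBot.1 hev
  have hlim := h.tendsto_fst_of_nonneg_on_Iic hs hc ha hT
  set k := (1 / s - c ^ 2 / 4) / 2 with hk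
  have hk0 : 0 < k := by
    have : 4 / s = 4 * (1 / s) := by ring
    rw [hk]
    linarith
  obtain ⟨b, hb⟩ := eventually_atBot.1
    ((hlim.eventually_ge_atTop (max 1 (1 / (s ^ 2 * k)))).and (eventually_le_atBot T))
  have hpos (x : ℝ) (hx : x ≤ b) : 0 < u x :=
    one_pos.trans_le ((le_max_left _ _).trans (hb x hx).1)
  have hR : Tendsto (fun x ↦ v x / u x) atBot atTop := by
    refine tendsto_atBot_atTop_of_hasDerivAt_le hk0 (b := b)
      (fun x hx ↦ (h.hasDerivAt_snd x).div (h.hasDerivAt_fst x) (hpos x hx).ne') fun x hx ↦ ?_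
    have hx0 := hpos x hx
    have hx1 : 1 ≤ u x := (le_max_left _ _).trans (hb x hx).1
    have hx2 : 1 / (s ^ 2 * k) ≤ u x := (le_max_right _ _).trans (hb x hx).1
    have hrem : 1 / (s * (1 + s * u x ^ 2)) ≤ k := by
      rw [div_le_iff₀ (by positivity)] at hx2 ⊢
      have : u x * (s ^ 2 * k) ≤ u x * (s ^ 2 * k) * u x :=
        le_mul_of_one_le_right (by positivity) hx1
      nlinarith [mul_pos hk0 hs]
    have hden := (one_add_mul_sq_pos hs (u x)).ne'
    have : ((-c * v x - reaction s (u x)) * u x - v x * v x) / u x ^ 2 =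
        -((v x / u x + c / 2) ^ 2 + (1 / s - c ^ 2 / 4) - 1 / (s * (1 + s * u x ^ 2))) := by
      rw [reaction_eq_sub hs]
      field_simp
      ring
    rw [this]
    have := sq_nonneg (v x / u x + c / 2)
    linarith
  obtain ⟨x, hx, hxb⟩ := ((hR.eventually_gt_atTop 0).and (eventually_le_atBot b)).exists
  exact absurd hx (not_lt.2 (div_nonpos_of_nonpos_of_nonneg
    (h.snd_nonpos_of_nonneg_on_Iic hs hc hT (hb x hxb).2) (hpos x hxb).le))

/-- The orbit dips below zero, rises and dips again; at the maximum in between `v = 0`, so the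
norm of the orbit, which is large, equals the value of `u`. -/
theorem frequently_lt_fst (hs : 0 < s) (hc : 0 < c) (hc' : c ^ 2 < 4 / s)
    (h : IsOrbit s c u v) {a : ℝ} (ha : 0 < lyapunov s c (u a) (v a)) (M : ℝ) :
    ∃ᶠ x in atBot, M < u x := by
  have hlt : ∃ᶠ x in atBot, u x < 0 := by
    simpa [Filter.Frequently] using h.not_eventually_nonneg hs hc hc' ha
  have hgt : ∃ᶠ x in atBot, 0 < u x := by
    simpa [Filter.Frequently] using h.neg.not_eventually_nonneg hs hc hc' (a := a)
      (by rwa [lyapunov_neg])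
  refine frequently_atBot.2 fun T ↦ ?_
  obtain ⟨b, hb⟩ := eventually_atBot.1 (((h.tendsto_norm_atBot_atTop hs hc ha).eventually_gt_atTop
    M).and (eventually_le_atBot T))
  obtain ⟨x₁, hx₁, hu₁⟩ := frequently_atBot.1 hlt b
  obtain ⟨x₂, hx₂, hu₂⟩ := frequently_atBot.1 hgt x₁
  obtain ⟨x₃, hx₃, hu₃⟩ := frequently_atBot.1 hlt x₂
  obtain ⟨y, hy, hmax⟩ := isCompact_Icc.exists_isMaxOn
    (Set.nonempty_Icc.2 (hx₃.trans hx₂)) h.continuous_fst.continuousOn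
  have hy0 : 0 < u y := hu₂.trans_le (hmax ⟨hx₃, hx₂⟩)
  have hy3 : x₃ < y := hy.1.lt_of_ne (by rintro rfl; linarith)
  have hy1 : y < x₁ := hy.2.lt_of_ne (by rintro rfl; linarith)
  have hvy : v y = 0 :=
    (hmax.isLocalMax (Icc_mem_nhds hy3 hy1)).hasDerivAt_eq_zero (h.hasDerivAt_fst y)
  obtain ⟨hM, hyT⟩ := hb y (hy.2.trans hx₁)
  refine ⟨y, hyT, ?_⟩
  simpa [Prod.norm_def, hvy, abs_of_pos hy0, hy0.le] using hM

theorem changesSignAt_of_fst_eq_zero (h : IsOrbit s c u v) {x : ℝ} (hx : u x = 0)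
    (hv : v x ≠ 0) : ChangesSignAt u x := by
  have key {u v : ℝ → ℝ} (h : IsOrbit s c u v) (hx : u x = 0) (hv : 0 < v x) :
      (∀ᶠ y in 𝓝[<] x, u y < 0) ∧ ∀ᶠ y in 𝓝[>] x, 0 < u y := by
    have hslope := (hasDerivAt_iff_tendsto_slope.1 (h.hasDerivAt_fst x)).eventually_const_lt hv
    have hmem : ∀ᶠ y in 𝓝[≠] x, 0 < u y * (y - x) := by
      filter_upwards [hslope, self_mem_nhdsWithin] with y hy hne
      have hne' : y - x ≠ 0 := sub_ne_zero.2 hne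
      rw [slope_def_field, hx, sub_zero] at hy
      have := mul_pos hy (sq_pos_of_ne_zero hne')
      rwa [show u y / (y - x) * (y - x) ^ 2 = u y * (y - x) by field_simp] at this
    constructor
    · filter_upwards [hmem.filter_mono (nhdsLT_le_nhdsNE x), self_mem_nhdsWithin] with y hy hlt
      exact neg_of_mul_pos_left hy (sub_neg.2 hlt).le
    · filter_upwards [hmem.filter_mono (nhdsGT_le_nhdsNE x), self_mem_nhdsWithin] with y hy hlt
      exact pos_of_mul_pos_left hy (sub_pos.2 hlt).le
  rcases hv.lt_or_gt with hv | hv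
  · right
    have := key h.neg (by simpa using hx) (by simpa using hv)
    simpa using this
  · exact .inl (key h hx hv)

theorem isOscillatingUnboundedWave (hs : 0 < s) (hc : 0 < c) (hc' : c ^ 2 < 4 / s)
    (h : IsOrbit s c u v) {a : ℝ} (ha : 0 < lyapunov s c (u a) (v a)) :
    IsOscillatingUnboundedWave s c u := by
  have hgt := h.frequently_lt_fst hs hc hc' ha
  have hlt (M : ℝ) : ∃ᶠ x in atBot, u x < M := by
    refine (h.neg.frequently_lt_fst hs hc hc' (a := a) (by rwa [lyapunov_neg]) (-M)).mono
      fun x hx ↦ ?_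
    linarith
  refine ⟨h.isWaveProfile hs, h.tendsto_atTop_zero hs hc, ?_, hgt, hlt, fun hfin ↦ ?_⟩
  · rw [h.deriv_fst]
    exact h.tendsto_norm_atBot_atTop hs hc ha
  · obtain ⟨b, hb⟩ := hfin.bddBelow
    obtain ⟨x₁, hx₁, hu₁⟩ := frequently_atBot.1 (hgt 0) (b - 1)
    obtain ⟨x₂, hx₂, hu₂⟩ := frequently_atBot.1 (hlt 0) x₁
    obtain ⟨y, hy, hy0⟩ := intermediate_value_Icc hx₂ h.continuous_fst.continuousOn
      ⟨hu₂.le, hu₁.le⟩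
    have := hb (h.changesSignAt_of_fst_eq_zero hy0 (h.snd_ne_zero_of_fst_eq_zero hs hc ha hy0))
    linarith [hy.2]

end IsOrbit

/-! ### Fast waves: a single turning point -/

namespace IsOrbit

variable {s c : ℝ} {u v : ℝ → ℝ}

/-- To the left of a downward zero of `u`, the orbit stays below the line `v = l u`, where
`l = l₁` is the smaller root of the characteristic polynomial `X² + c X + 1/s` at infinity and
`l₂` the other one: `w = v - l₁ u` satisfies `w' = l₂ w + (u/s - f(u))`, and the last term is
positive for `u > 0`. -/
theorem snd_lt_mul_fst_of_pos_on_Ioo (hs : 0 < s) {l₁ l₂ : ℝ} (hsum : l₁ + l₂ = -c)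
    (hprod : l₁ * l₂ = 1 / s) (h : IsOrbit s c u v) {a b : ℝ} (hua : u a = 0) (hva : v a < 0)
    (hpos : ∀ x ∈ Set.Ioo b a, 0 < u x) {x : ℝ} (hx : x ∈ Set.Icc b a) : v x < l₁ * u x := by
  have hexp (y : ℝ) : HasDerivAt (fun x ↦ Real.exp (-l₂ * x)) (Real.exp (-l₂ * y) * -l₂) y := by
    simpa using ((hasDerivAt_id y).const_mul (-l₂)).exp
  have hw (y : ℝ) : HasDerivAt (fun x ↦ Real.exp (-l₂ * x) * (v x - l₁ * u x))
      (Real.exp (-l₂ * y) * (u y / (s * (1 + s * u y ^ 2)))) y := by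
    refine ((hexp y).mul ((h.hasDerivAt_snd y).sub
      ((h.hasDerivAt_fst y).const_mul l₁))).congr_deriv ?_
    rw [reaction_eq_sub hs, show u y / s = l₁ * l₂ * u y by rw [hprod]; ring,
      show c = -(l₁ + l₂) by linarith]
    simp only [Pi.sub_apply]
    ring
  have hmono : MonotoneOn (fun x ↦ Real.exp (-l₂ * x) * (v x - l₁ * u x)) (Set.Icc b a) := by
    refine monotoneOn_of_deriv_nonneg (convex_Icc b a)
      (fun y _ ↦ (hw y).continuousAt.continuousWithinAt)
      (fun y _ ↦ (hw y).differentiableAt.differentiableWithinAt) fun y hy ↦ ?_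
    rw [(hw y).deriv]
    rw [interior_Icc] at hy
    have := hpos y hy
    positivity
  have h1 : Real.exp (-l₂ * x) * (v x - l₁ * u x) ≤ Real.exp (-l₂ * a) * (v a - l₁ * u a) :=
    hmono hx (Set.right_mem_Icc.2 (hx.1.trans hx.2)) hx.2
  have h2 : Real.exp (-l₂ * a) * (v a - l₁ * u a) < 0 :=
    mul_neg_of_pos_of_neg (Real.exp_pos _) (by rwa [hua, mul_zero, sub_zero])
  exact sub_neg.1 (neg_of_mul_neg_right (h1.trans_lt h2) (Real.exp_nonneg _))

/-- Otherwise, at the last point `b < a` with `v ≥ 0`, `snd_lt_mul_fst_of_pos_on_Ioo` would give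
`v < l₁ u < 0`. -/
theorem snd_neg_of_le (hs : 0 < s) {l₁ l₂ : ℝ} (hsum : l₁ + l₂ = -c)
    (hprod : l₁ * l₂ = 1 / s) (hl : l₁ < 0) (h : IsOrbit s c u v) {a : ℝ} (hua : u a = 0)
    (hva : v a < 0) {x : ℝ} (hx : x ≤ a) : v x < 0 := by
  by_contra! hvx
  obtain ⟨b, ⟨⟨-, hba⟩, hvb⟩, hbmax⟩ :=
    (isCompact_Icc.inter_right (isClosed_Ici.preimage h.continuous_snd)).exists_isGreatest
      (⟨x, ⟨le_rfl, hx⟩, hvx⟩ : (Set.Icc x a ∩ v ⁻¹' Set.Ici 0).Nonempty)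
  have hxb : x ≤ b := hbmax ⟨⟨le_rfl, hx⟩, hvx⟩
  have hvneg (y : ℝ) (hy : y ∈ Set.Ioo b a) : v y < 0 := by
    by_contra! hvy
    exact absurd (hbmax ⟨⟨hxb.trans hy.1.le, hy.2.le⟩, hvy⟩) (not_le.2 hy.1)
  have hanti : StrictAntiOn u (Set.Icc b a) :=
    strictAntiOn_of_deriv_neg (convex_Icc b a) h.continuous_fst.continuousOn fun y hy ↦ by
      rw [h.deriv_fst]
      exact hvneg y (by rwa [interior_Icc] at hy)
  have hpos (y : ℝ) (hy : y ∈ Set.Icc b a) (hya : y < a) : 0 < u y :=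
    hua ▸ hanti hy (Set.right_mem_Icc.2 hba) hya
  have hba' : b < a := hba.lt_of_ne fun hab ↦ absurd hva (not_lt.2 (hab ▸ hvb))
  have hb : b ∈ Set.Icc b a := Set.left_mem_Icc.2 hba
  have hlt := h.snd_lt_mul_fst_of_pos_on_Ioo hs hsum hprod hua hva
    (fun y hy ↦ hpos y (Set.Ioo_subset_Icc_self hy) hy.2) hb
  exact absurd (hlt.trans (mul_neg_of_neg_of_pos hl (hpos b hb hba'))) (not_lt.2 hvb)

theorem strictAntiOn_Iic (hs : 0 < s) {l₁ l₂ : ℝ} (hsum : l₁ + l₂ = -c)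
    (hprod : l₁ * l₂ = 1 / s) (hl : l₁ < 0) (h : IsOrbit s c u v) {a : ℝ} (hua : u a = 0)
    (hva : v a < 0) : StrictAntiOn u (Set.Iic a) :=
  strictAntiOn_of_deriv_neg (convex_Iic a) h.continuous_fst.continuousOn fun y hy ↦ by
    rw [h.deriv_fst]
    exact h.snd_neg_of_le hs hsum hprod hl hua hva (interior_subset hy : y ∈ Set.Iic a)

theorem fst_pos_of_lt (hs : 0 < s) {l₁ l₂ : ℝ} (hsum : l₁ + l₂ = -c)
    (hprod : l₁ * l₂ = 1 / s) (hl : l₁ < 0) (h : IsOrbit s c u v) {a : ℝ} (hua : u a = 0)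
    (hva : v a < 0) {x : ℝ} (hx : x < a) : 0 < u x :=
  hua ▸ h.strictAntiOn_Iic hs hsum hprod hl hua hva hx.le (Set.mem_Iic.2 le_rfl) hx

theorem tendsto_atBot_atTop (hs : 0 < s) {l₁ l₂ : ℝ} (hsum : l₁ + l₂ = -c)
    (hprod : l₁ * l₂ = 1 / s) (hl : l₁ < 0) (h : IsOrbit s c u v) {a : ℝ} (hua : u a = 0)
    (hva : v a < 0) : Tendsto u atBot atTop := by
  have hpos := h.fst_pos_of_lt hs hsum hprod hl hua hva (sub_one_lt a)
  refine tendsto_atBot_atTop_of_hasDerivAt_le (mul_pos (neg_pos.2 hl) hpos) (b := a - 1)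
    (fun y _ ↦ h.hasDerivAt_fst y) fun y hy ↦ ?_
  have hya : y ≤ a := hy.trans (sub_one_lt a).le
  have h1 := h.snd_lt_mul_fst_of_pos_on_Ioo hs hsum hprod hua hva
    (fun z hz ↦ h.fst_pos_of_lt hs hsum hprod hl hua hva hz.2) (Set.left_mem_Icc.2 hya)
  have h2 : u (a - 1) ≤ u y :=
    (h.strictAntiOn_Iic hs hsum hprod hl hua hva).antitoneOn hya (sub_one_lt a).le hy
  nlinarith

/-- A second zero, to the right of a downward zero at `0`, would be transversal, so `u` would
have a strict sign on the whole left of it, `0` included. -/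
theorem fst_neg_of_pos (hs : 0 < s) (hc : 0 < c) {l₁ l₂ : ℝ} (hsum : l₁ + l₂ = -c)
    (hprod : l₁ * l₂ = 1 / s) (hl : l₁ < 0) (h : IsOrbit s c u v) {a : ℝ} (hua : u a = 0)
    (hva : v a < 0) {x : ℝ} (hx : a < x) : u x < 0 := by
  have hne (y : ℝ) (hy : a < y) : u y ≠ 0 := fun huy ↦ by
    rcases (h.snd_ne_zero_of_fst_eq_zero hs hc
      (lyapunov_pos_of_snd_ne_zero hs c (u a) hva.ne) huy).lt_or_gt with hvy | hvy
    · exact (h.fst_pos_of_lt hs hsum hprod hl huy hvy hy).ne' hua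
    · have := h.neg.fst_pos_of_lt hs hsum hprod hl (a := y) (by simpa using huy)
        (by simpa using hvy) hy
      simp [hua] at this
  obtain ⟨z, hz, hza⟩ : ∃ z, u z < 0 ∧ a < z := by
    by_contra! hcon
    have hmin : IsMinOn u (Set.Icc (a - 1) (a + 1)) a := fun y hy ↦ by
      change u a ≤ u y
      rw [hua]
      rcases lt_trichotomy y a with hya | rfl | hya
      · exact (h.fst_pos_of_lt hs hsum hprod hl hua hva hya).le
      · exact hua.ge
      · exact le_of_not_gt fun hneg ↦ absurd hya (not_lt.2 (hcon y hneg))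
    exact hva.ne ((hmin.isLocalMin (Icc_mem_nhds (by linarith) (by linarith))).hasDerivAt_eq_zero
      (h.hasDerivAt_fst a))
  by_contra! hux
  obtain ⟨y, hy, huy⟩ := isPreconnected_Ioi.intermediate_value (s := Set.Ioi a) hza hx
    h.continuous_fst.continuousOn ⟨hz.le, hux⟩
  exact hne y hy huy

/-- Since `u < 0` beyond `a`, the function `e^{c x} v` is strictly increasing there. It vanishes
somewhere because `u` has to return to `0` at `+∞`. -/
theorem exists_isNegativeTurningPoint (hs : 0 < s) (hc : 0 < c) {l₁ l₂ : ℝ} (hsum : l₁ + l₂ = -c)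
    (hprod : l₁ * l₂ = 1 / s) (hl : l₁ < 0) (h : IsOrbit s c u v) {a : ℝ} (hua : u a = 0)
    (hva : v a < 0) : ∃ ξ, IsNegativeTurningPoint u ξ := by
  have hneg (x : ℝ) (hx : a < x) : u x < 0 := h.fst_neg_of_pos hs hc hsum hprod hl hua hva hx
  have hmono : StrictMonoOn (fun x ↦ Real.exp (c * x) * v x) (Set.Ici a) := by
    refine strictMonoOn_of_deriv_pos (convex_Ici a)
      (fun y _ ↦ (h.hasDerivAt_exp_mul_snd y).continuousAt.continuousWithinAt) fun y hy ↦ ?_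
    rw [interior_Ici] at hy
    rw [(h.hasDerivAt_exp_mul_snd y).deriv, ← mul_neg, ← reaction_neg]
    exact mul_pos (Real.exp_pos _) (reaction_pos hs (neg_pos.2 (hneg y hy)))
  obtain ⟨z, hz, hvz⟩ : ∃ z, a < z ∧ 0 ≤ v z := by
    by_contra! hcon
    have hanti : AntitoneOn u (Set.Ici a) :=
      antitoneOn_of_deriv_nonpos (convex_Ici a) h.continuous_fst.continuousOn
        (fun y _ ↦ (h.hasDerivAt_fst y).differentiableAt.differentiableWithinAt) fun y hy ↦ by
          rw [interior_Ici] at hy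
          rw [h.deriv_fst]
          exact (hcon y hy).le
    have hlt := hneg (a + 1) (lt_add_one a)
    obtain ⟨x, hx, hxa⟩ := (((h.tendsto_atTop_zero hs hc).eventually_const_lt hlt).and
      (eventually_ge_atTop (a + 1))).exists
    exact absurd (hanti (lt_add_one a).le ((lt_add_one a).le.trans hxa) hxa) (not_le.2 hx)
  obtain ⟨ξ, hξ, hvξ⟩ := intermediate_value_Icc hz.le h.continuous_snd.continuousOn ⟨hva.le, hvz⟩
  have haξ : a < ξ := hξ.1.lt_of_ne (by rintro rfl; exact hva.ne hvξ)
  refine ⟨ξ, ?_⟩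
  rw [IsNegativeTurningPoint, h.deriv_fst]
  refine ⟨fun x hx ↦ ?_, hvξ, hneg ξ haξ, fun x hx ↦ ?_⟩
  · rcases le_total x a with hxa | hxa
    · exact h.snd_neg_of_le hs hsum hprod hl hua hva hxa
    · have := hmono hxa haξ.le hx
      simp only [hvξ, mul_zero] at this
      exact neg_of_mul_neg_right this (Real.exp_nonneg _)
  · have := hmono haξ.le (haξ.le.trans hx.le) hx
    simp only [hvξ, mul_zero] at this
    exact pos_of_mul_pos_right this (Real.exp_nonneg _)

end IsOrbit

theorem IsNegativeTurningPoint.eq {φ : ℝ → ℝ} {ξ η : ℝ} (hξ : IsNegativeTurningPoint φ ξ)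
    (hη : IsNegativeTurningPoint φ η) : ξ = η := by
  rcases lt_trichotomy ξ η with h | h | h
  · exact absurd hξ.2.1 (hη.1 ξ h).ne
  · exact h
  · exact absurd hη.2.1 (hξ.1 η h).ne

/-! ### Existence of the two kinds of waves -/

theorem exists_roots_of_critical_le {s c : ℝ} (hs : 0 < s) (hc : 2 / √s ≤ c) :
    ∃ l₁ l₂ : ℝ, l₁ + l₂ = -c ∧ l₁ * l₂ = 1 / s ∧ l₁ < 0 := by
  have h0 : 0 < 2 / √s := by positivity
  have hd : 0 ≤ c ^ 2 - 4 / s := by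
    have : (2 / √s) ^ 2 ≤ c ^ 2 := by gcongr
    rw [div_pow, Real.sq_sqrt hs.le] at this
    linarith
  refine ⟨(-c - √(c ^ 2 - 4 / s)) / 2, (-c + √(c ^ 2 - 4 / s)) / 2, by ring, ?_, ?_⟩
  · have := Real.sq_sqrt hd
    linear_combination -this / 4
  · linarith [Real.sqrt_nonneg (c ^ 2 - 4 / s)]

theorem theorem2 (s : ℝ) (hs : 0 < s) :
    ∃ cStar : ℝ, 0 < cStar ∧ cStar = 2 / Real.sqrt s ∧
      (∀ c : ℝ, 0 < c → c < cStar → ∃ φ : ℝ → ℝ, IsOscillatingUnboundedWave s c φ) ∧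
      (∀ c : ℝ, cStar ≤ c →
        ∃ Φ : Set.Ioi (0 : ℝ) → ℝ → ℝ,
          (∀ p, IsWaveProfile s c (Φ p) ∧ ConnectsInftyZero (Φ p) ∧
            ∃! ξ₀ : ℝ, IsNegativeTurningPoint (Φ p) ξ₀) ∧
          (∀ p q, p ≠ q → ∀ a : ℝ, Φ p ≠ fun ξ => Φ q (ξ + a))) := by
  have hcs : 0 < 2 / √s := by positivity
  refine ⟨2 / √s, hcs, rfl, fun c hc hlt ↦ ?_, fun c hle ↦ ?_⟩
  · have hc' : c ^ 2 < 4 / s := by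
      have : c ^ 2 < (2 / √s) ^ 2 := by gcongr
      rw [div_pow, Real.sq_sqrt hs.le] at this
      linarith
    obtain ⟨u, v, -, hv, h⟩ := exists_isOrbit hs c 0 1
    exact ⟨u, h.isOscillatingUnboundedWave hs hc hc' (a := 0)
      (lyapunov_pos_of_snd_ne_zero hs c _ (by simp [hv]))⟩
  · have hc : 0 < c := hcs.trans_le hle
    obtain ⟨l₁, l₂, hsum, hprod, hl⟩ := exists_roots_of_critical_le hs hle
    -- The family consists of the orbits through the points `(0, -p)` of the phase plane.
    choose Φ Ψ hΦ hΨ h using fun p : Set.Ioi (0 : ℝ) ↦ exists_isOrbit hs c 0 (-(p : ℝ))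
    have hneg (p : Set.Ioi (0 : ℝ)) : Ψ p 0 < 0 := by
      rw [hΨ]
      exact neg_neg_of_pos p.2
    refine ⟨Φ, fun p ↦ ⟨(h p).isWaveProfile hs,
      ⟨(h p).tendsto_atBot_atTop hs hsum hprod hl (hΦ p) (hneg p),
        (h p).tendsto_atTop_zero hs hc⟩, ?_⟩, fun p q hpq a heq ↦ ?_⟩
    · obtain ⟨ξ, hξ⟩ := (h p).exists_isNegativeTurningPoint hs hc hsum hprod hl (hΦ p) (hneg p)
      exact ⟨ξ, hξ, fun η hη ↦ hη.eq hξ⟩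
    · -- Every member of the family vanishes at `0` only, with slope `-p` there.
      have hqa : Φ q a = 0 := by
        have := congrFun heq 0
        rwa [hΦ, zero_add, eq_comm] at this
      have ha : a = 0 := by
        rcases lt_trichotomy a 0 with ha | ha | ha
        · exact absurd hqa
            ((h q).fst_pos_of_lt hs hsum hprod hl (hΦ q) (hneg q) ha).ne'
        · exact ha
        · exact absurd hqa
            ((h q).fst_neg_of_pos hs hc hsum hprod hl (hΦ q) (hneg q) ha).ne
      have hder : Ψ p 0 = Ψ q 0 := by
        rw [← (h p).deriv_fst, ← (h q).deriv_fst, heq]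
        simp [ha]
      rw [hΨ, hΨ, neg_inj] at hder
      exact hpq (Subtype.ext hder)
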